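/- For $n\ge 1$ and $1\le i\le 2^{n-1}$ let $\eta_{n,i}:[0,1]\to\mathbb R$ be the Faber--Schauder function equal to $2^{(n-1)/2}\bigl(t-\tfrac{2i-2}{2^n}\bigr)$ on $\bigl[\tfrac{2i-2}{2^n},\tfrac{2i-1}{2^n}\bigr]$, to $2^{(n-1)/2}\bigl(\tfrac{2i}{2^n}-t\bigr)$ on $\bigl[\tfrac{2i-1}{2^n},\tfrac{2i}{2^n}\bigr]$, and to $0$ elsewhere. Let $X_0$ and $X_{n,i}$ ($n\ge1$, $1\le i\le 2^{n-1}$) be independent standard normal random variables on a probability space, and let $B$ be standard Brownian motion on $[0,1]$ given by the Lévy--Ciesielski expansion: almost surely, for all $t\in[0,1]$, $$B(t)=X_0\,t+\sum_{n=1}^{\infty}\sum_{i=1}^{2^{n-1}}X_{n,i}\,\eta_{n,i}(t),$$ with truncations $$B_N(t)=X_0\,t+\sum_{n=1}^{N}\sum_{i=1}^{2^{n-1}}X_{n,i}\,\eta_{n,i}(t)\qquad(N\ge 1).$$ Let $r>0$, $\sigma>0$ and $S(0),K\in\mathbb R$, and define the discounted payoff of the continuous arithmetic Asian call option with strike $K$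 and maturity $1$ in the Black--Scholes model, and its approximation, by $$P=e^{-r}\max\Bigl(S(0)\int_0^1 e^{(r-\sigma^2/2)t+\sigma B(t)}\,dt-K,\,0\Bigr),\qquad P_N=e^{-r}\max\Bigl(S(0)\int_0^1 e^{(r-\sigma^2/2)t+\sigma B_N(t)}\,dt-K,\,0\Bigr).$$ Then, almost surely, the series for $B(t)$ converges for every $t\in[0,1]$ and $B$ is continuous on $[0,1]$ (so that $P$ is well defined), $P-P_N$ is integrable for every $N\ge 1$, and, with $d=2^N$, there are constants $C,C'>0$ independent of $N$ such that for all $N\ge 1$ $$\mathbb E\bigl[|P-P_N|\bigr]\le C\,\frac{\sqrt N}{2^{N/2}}\qquad\text{and}\qquad \mathbb E\bigl[|P-P_N|\bigr]\le C'\sqrt{\frac{\ln d}{d}}.$$ -/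

import Mathlib

open MeasureTheory ProbabilityTheory Set

noncomputable section

open scoped Classical in
/-- The Faber–Schauder function `η_{n,i}` (`n ≥ 1`, `1 ≤ i ≤ 2^(n-1)`): the hat function supported on
`[(2i-2)/2^n, 2i/2^n]` with slopes `± 2^((n-1)/2)`. -/
def faberSchauder (n i : ℕ) (t : ℝ) : ℝ :=
  if t ∈ Icc ((2 * (i : ℝ) - 2) / 2 ^ n) ((2 * (i : ℝ) - 1) / 2 ^ n) then
    (2 : ℝ) ^ (((n : ℝ) - 1) / 2) * (t - (2 * (i : ℝ) - 2) / 2 ^ n)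
  else if t ∈ Icc ((2 * (i : ℝ) - 1) / 2 ^ n) ((2 * (i : ℝ)) / 2 ^ n) then
    (2 : ℝ) ^ (((n : ℝ) - 1) / 2) * ((2 * (i : ℝ)) / 2 ^ n - t)
  else 0

/-- The level-`n` part `∑_{i=1}^{2^(n-1)} x_{n,i} η_{n,i}(t)` (`n ≥ 1`). The coefficients are stored in
one sequence: `x 0` is `x_0`, and `x (2^(n-1) + (i-1))` is `x_{n,i}`; this is a bijective labelling. -/
def lcLevel (x : ℕ → ℝ) (n : ℕ) (t : ℝ) : ℝ :=
  ∑ i ∈ Finset.Icc 1 (2 ^ (n - 1)), x (2 ^ (n - 1) + (i - 1)) * faberSchauder n i t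

/-- The truncated Lévy–Ciesielski expansion
`B_N(x)(t) = x_0 t + ∑_{n=1}^N ∑_{i=1}^{2^(n-1)} x_{n,i} η_{n,i}(t)`. -/
def lcTrunc (x : ℕ → ℝ) (N : ℕ) (t : ℝ) : ℝ :=
  x 0 * t + ∑ n ∈ Finset.Icc 1 N, lcLevel x n t

/-- The full Lévy–Ciesielski expansion
`B(x)(t) = x_0 t + ∑_{n=1}^∞ ∑_{i=1}^{2^(n-1)} x_{n,i} η_{n,i}(t)`. -/
def lcPath (x : ℕ → ℝ) (t : ℝ) : ℝ :=
  x 0 * t + ∑' n : ℕ, lcLevel x (n + 1) t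

/-- The Black–Scholes asset price `S(t) = S(0) exp((r - σ²/2) t + σ b(t))` driven by the path `b`. -/
def assetPrice (S₀ r σ : ℝ) (b : ℝ → ℝ) (t : ℝ) : ℝ :=
  S₀ * Real.exp ((r - σ ^ 2 / 2) * t + σ * b t)

/-- The discounted payoff, with maturity `T = 1`, strike `K` and risk-free rate `r`, of the continuous
arithmetic Asian call on an asset with price path `S`. -/
def asianCallPayoff (r K : ℝ) (S : ℝ → ℝ) : ℝ :=
  Real.exp (-r) * max ((∫ t in (0 : ℝ)..1, S t) - K) 0

end

/-!
At a fixed time `t` at most one Faber–Schauder function of each level is nonzero, and on level `n`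
it is at most `2^(-(n+1)/2)`. Hence `B_N t` is a combination of `N + 1` independent coefficients
with geometrically decaying weights: `B_N t` and its limit `B t` are sub-Gaussian uniformly in `N`
and `t`, and the tail `B t - B_N t` is sub-Gaussian with variance proxy of order `δ² = 2^(-N)`.
Since `|e^x - e^y| ≤ |x - y| (e^x + e^y)` and the payoff is Lipschitz in the time average of the
price, the error is controlled by `∫₀¹ 𝔼 |B t - B_N t| (e^(σ B t) + e^(σ B_N t)) dt`, which is
`O(δ)`. Almost sure convergence of the series holds because sub-Gaussian coefficients grow at most
logarithmically, hence at most linearly in the level.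
-/

open Filter Topology
open scoped NNReal ENNReal

theorem sqrt_half_pow_eq_one_div_two_rpow (n : ℕ) :
    √(1 / 2 : ℝ) ^ n = 1 / (2 : ℝ) ^ ((n : ℝ) / 2) := by
  rw [Real.sqrt_eq_rpow, ← Real.rpow_mul_natCast (by norm_num), one_div_mul_eq_div,
    Real.div_rpow zero_le_one zero_le_two, Real.one_rpow]

theorem sqrt_half_lt_one : √(1 / 2 : ℝ) < 1 := by
  rw [Real.sqrt_lt' one_pos]
  norm_num

theorem faberSchauder_eq_mul_max (n i : ℕ) (t : ℝ) :
    faberSchauder n i t =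
      √(1 / 2) ^ (n + 1) * max 0 (1 - |2 ^ n * t - (2 * (i : ℝ) - 1)|) := by
  have hpow : (0 : ℝ) < 2 ^ n := by positivity
  have hscale : √(1 / 2 : ℝ) ^ (n + 1) = 2 ^ (((n : ℝ) - 1) / 2) / 2 ^ n := by
    rw [sqrt_half_pow_eq_one_div_two_rpow, div_eq_div_iff (by positivity) hpow.ne', one_mul,
      ← Real.rpow_natCast, ← Real.rpow_add two_pos]
    congr 1
    push_cast
    ring
  rw [hscale]
  unfold faberSchauder
  simp only [mem_Icc, div_le_iff₀ hpow, le_div_iff₀ hpow]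
  split_ifs with hleft hright
  · rw [abs_of_nonpos (by linarith), max_eq_right (by linarith)]
    field_simp
    ring
  · rw [abs_of_nonneg (by linarith), max_eq_right (by linarith)]
    field_simp
    ring
  · rw [max_eq_left, mul_zero]
    rw [sub_nonpos, le_abs]
    grind

theorem continuous_faberSchauder (n i : ℕ) : Continuous (faberSchauder n i) := by
  rw [funext (faberSchauder_eq_mul_max n i)]
  fun_prop

theorem abs_faberSchauder_le (n i : ℕ) (t : ℝ) : |faberSchauder n i t| ≤ √(1 / 2) ^ (n + 1) := by
  rw [faberSchauder_eq_mul_max, abs_of_nonneg (by positivity)]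
  refine mul_le_of_le_one_right (by positivity) (max_le zero_le_one ?_)
  linarith [abs_nonneg (2 ^ n * t - (2 * (i : ℝ) - 1))]

theorem eq_of_faberSchauder_ne_zero {n i j : ℕ} {t : ℝ} (hi : faberSchauder n i t ≠ 0)
    (hj : faberSchauder n j t ≠ 0) : i = j := by
  have mem_support {l : ℕ} (hl : faberSchauder n l t ≠ 0) :
      |2 ^ n * t - (2 * (l : ℝ) - 1)| < 1 := by
    contrapose! hl
    rw [faberSchauder_eq_mul_max, max_eq_left (by linarith), mul_zero]
  have hi' := abs_lt.1 (mem_support hi)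
  have hj' := abs_lt.1 (mem_support hj)
  have hij : (i : ℝ) < j + 1 := by linarith
  have hji : (j : ℝ) < i + 1 := by linarith
  norm_cast at hij hji
  omega

theorem exists_lcLevel_eq_mul (n : ℕ) (t : ℝ) :
    ∃ k : ℕ, ∃ c : ℝ, 2 ^ n ≤ k ∧ k < 2 ^ (n + 1) ∧ |c| ≤ √(1 / 2) ^ (n + 2) ∧
      ∀ x : ℕ → ℝ, lcLevel x (n + 1) t = c * x k := by
  obtain ⟨i, hi, hunique⟩ : ∃ i ∈ Finset.Icc 1 (2 ^ n), ∀ j ∈ Finset.Icc 1 (2 ^ n), j ≠ i →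
      faberSchauder (n + 1) j t = 0 := by
    by_cases h : ∃ i ∈ Finset.Icc 1 (2 ^ n), faberSchauder (n + 1) i t ≠ 0
    · obtain ⟨i, hi, hne⟩ := h
      exact ⟨i, hi, fun j _ hji => by_contra fun hj => hji (eq_of_faberSchauder_ne_zero hj hne)⟩
    · push Not at h
      exact ⟨1, Finset.mem_Icc.2 ⟨le_rfl, Nat.one_le_two_pow⟩, fun j hj _ => h j hj⟩
  refine ⟨2 ^ n + (i - 1), faberSchauder (n + 1) i t, Nat.le_add_right _ _, ?_,
    abs_faberSchauder_le _ _ _, fun x => ?_⟩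
  · rw [Finset.mem_Icc] at hi
    rw [pow_succ]
    omega
  · rw [lcLevel, Nat.add_sub_cancel, Finset.sum_eq_single_of_mem i hi
      (fun j hj hji => by rw [hunique j hj hji, mul_zero]), mul_comm]

theorem lcTrunc_eq_sum_range (x : ℕ → ℝ) (N : ℕ) (t : ℝ) :
    lcTrunc x N t = x 0 * t + ∑ n ∈ Finset.range N, lcLevel x (n + 1) t := by
  rw [lcTrunc, Finset.range_eq_Ico, Finset.sum_Ico_add' (fun n => lcLevel x n t) 0 N 1]
  rfl

theorem exists_lcTrunc_eq_sum_mul {t : ℝ} (ht : t ∈ Icc (0 : ℝ) 1) :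
    ∃ (k : ℕ → ℕ) (c : ℕ → ℝ), StrictMono k ∧ (∀ n, |c n| ≤ √(1 / 2) ^ n) ∧
      ∀ (x : ℕ → ℝ) (N : ℕ), lcTrunc x N t = ∑ n ∈ Finset.range (N + 1), c n * x (k n) := by
  choose k c hk_ge hk_lt hc hlevel using fun n => exists_lcLevel_eq_mul n t
  refine ⟨fun n => n.casesOn 0 k, fun n => n.casesOn t c, strictMono_nat_of_lt_succ fun n => ?_,
    fun n => ?_, fun x N => ?_⟩
  · cases n with
    | zero => exact (Nat.two_pow_pos 0).trans_le (hk_ge 0)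
    | succ n => exact (hk_lt n).trans_le (hk_ge (n + 1))
  · cases n with
    | zero =>
      change |t| ≤ √(1 / 2) ^ 0
      rw [pow_zero, abs_of_nonneg ht.1]
      exact ht.2
    | succ n =>
      exact (hc n).trans
        (pow_le_pow_of_le_one (Real.sqrt_nonneg _) sqrt_half_lt_one.le (Nat.le_succ _))
  · rw [lcTrunc_eq_sum_range, Finset.sum_range_succ', add_comm, mul_comm]
    simp only [hlevel]
    rfl

theorem continuous_lcLevel (n : ℕ) : Continuous fun p : (ℕ → ℝ) × ℝ => lcLevel p.1 n p.2 := by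
  unfold lcLevel
  have := continuous_faberSchauder n
  fun_prop

theorem continuous_lcTrunc (N : ℕ) : Continuous fun p : (ℕ → ℝ) × ℝ => lcTrunc p.1 N p.2 := by
  unfold lcTrunc
  have := continuous_lcLevel
  fun_prop

section LogGrowth

variable {x : ℕ → ℝ} {A : ℝ}

theorem abs_lcLevel_le (hx : ∀ j, |x j| ≤ A * (1 + Real.log (j + 1))) (n : ℕ) (t : ℝ) :
    |lcLevel x (n + 1) t| ≤ A * ((n + 2) * √(1 / 2) ^ (n + 2)) := by
  have hA : 0 ≤ A := by simpa using (abs_nonneg _).trans (hx 0)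
  obtain ⟨k, c, -, hk, hc, hlevel⟩ := exists_lcLevel_eq_mul n t
  have hlog : Real.log (k + 1) ≤ n + 1 :=
    calc Real.log (k + 1) ≤ Real.log (2 ^ (n + 1)) :=
          Real.log_le_log (by positivity) (by exact_mod_cast hk)
      _ = (n + 1) * Real.log 2 := by rw [Real.log_pow]; push_cast; rfl
      _ ≤ n + 1 := mul_le_of_le_one_right (by positivity) (by linarith [Real.log_two_lt_d9])
  calc |lcLevel x (n + 1) t| = |c| * |x k| := by rw [hlevel, abs_mul]
    _ ≤ √(1 / 2) ^ (n + 2) * (A * (1 + (n + 1))) := by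
        gcongr
        exact (hx k).trans (by gcongr)
    _ = A * ((n + 2) * √(1 / 2) ^ (n + 2)) := by ring

theorem summable_mul_sqrt_half_pow (A : ℝ) :
    Summable fun n : ℕ => A * ((n + 2) * √(1 / 2) ^ (n + 2)) := by
  have hnorm : ‖√(1 / 2 : ℝ)‖ < 1 := by
    rw [Real.norm_of_nonneg (Real.sqrt_nonneg _)]
    exact sqrt_half_lt_one
  have hsum : Summable fun n : ℕ => (n : ℝ) ^ 1 * √(1 / 2 : ℝ) ^ n :=
    summable_pow_mul_geometric_of_norm_lt_one 1 hnorm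
  have hshift := (summable_nat_add_iff 2).2 hsum
  simp only [pow_one, Nat.cast_add, Nat.cast_ofNat] at hshift
  exact hshift.mul_left A

theorem summable_lcLevel (hx : ∀ j, |x j| ≤ A * (1 + Real.log (j + 1))) (t : ℝ) :
    Summable fun n : ℕ => lcLevel x (n + 1) t :=
  .of_norm_bounded (summable_mul_sqrt_half_pow A) fun n => abs_lcLevel_le hx n t

theorem tendsto_lcTrunc (hx : ∀ j, |x j| ≤ A * (1 + Real.log (j + 1))) (t : ℝ) :
    Tendsto (fun N => lcTrunc x N t) atTop (𝓝 (lcPath x t)) := by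
  simp only [lcTrunc_eq_sum_range, lcPath]
  exact (summable_lcLevel hx t).hasSum.tendsto_sum_nat.const_add _

theorem continuous_lcPath (hx : ∀ j, |x j| ≤ A * (1 + Real.log (j + 1))) :
    Continuous (lcPath x) := by
  have hlevel (n : ℕ) : Continuous (lcLevel x (n + 1)) :=
    (continuous_lcLevel (n + 1)).comp (Continuous.prodMk_right x)
  exact (continuous_const_mul (x 0)).add
    (continuous_tsum hlevel (summable_mul_sqrt_half_pow A) (abs_lcLevel_le hx))

end LogGrowth

section Subgaussian

variable {Ω : Type*} [MeasurableSpace Ω] {μ : Measure Ω}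

theorem hasSubgaussianMGF_of_hasLaw_gaussianReal {Y : Ω → ℝ} {v : ℝ≥0}
    (hY : HasLaw Y (gaussianReal 0 v) μ) : HasSubgaussianMGF Y v μ := by
  have hmgf (s : ℝ) : mgf Y μ s = Real.exp (v * s ^ 2 / 2) := by
    rw [mgf_gaussianReal hY.map_eq, zero_mul, zero_add]
  have : IsProbabilityMeasure μ := hY.isProbabilityMeasure_iff.2 inferInstance
  exact ⟨fun s => mgf_pos_iff.1 (hmgf s ▸ Real.exp_pos _), fun s => (hmgf s).le⟩

theorem hasSubgaussianMGF_mono {Y : Ω → ℝ} {v w : ℝ≥0} (hY : HasSubgaussianMGF Y v μ)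
    (hvw : v ≤ w) : HasSubgaussianMGF Y w μ :=
  ⟨hY.integrable_exp_mul, fun s => (hY.mgf_le s).trans (by gcongr)⟩

theorem hasSubgaussianMGF_const_mul {Y : Ω → ℝ} {v w : ℝ≥0} {a : ℝ}
    (hY : HasSubgaussianMGF Y v μ) (ha : a ^ 2 * v ≤ w) :
    HasSubgaussianMGF (fun ω => a * Y ω) w μ :=
  hasSubgaussianMGF_mono (hY.const_mul a) (NNReal.coe_le_coe.1 ha)

theorem hasSubgaussianMGF_sum_mul {ι : Type*} {X : ι → Ω → ℝ} {v w : ℝ≥0}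
    (hX : ∀ i, HasSubgaussianMGF (X i) v μ) (hind : iIndepFun X μ) {a : ι → ℝ} {s : Finset ι}
    (ha : ∑ i ∈ s, a i ^ 2 ≤ w) :
    HasSubgaussianMGF (fun ω => ∑ i ∈ s, a i * X i ω) (w * v) μ := by
  have hind_mul : iIndepFun (fun i ω => a i * X i ω) μ :=
    hind.comp (fun i y => a i * y) fun i => measurable_const_mul (a i)
  have hterm (i : ι) : HasSubgaussianMGF (fun ω => a i * X i ω) (‖a i‖₊ ^ 2 * v) μ :=
    hasSubgaussianMGF_const_mul (hX i) (by simp)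
  refine hasSubgaussianMGF_mono (.sum_of_iIndepFun hind_mul fun i _ => hterm i) ?_
  rw [← Finset.sum_mul]
  gcongr
  rw [← NNReal.coe_le_coe]
  simpa using ha

theorem hasSubgaussianMGF_of_tendsto_ae {Y : ℕ → Ω → ℝ} {Z : Ω → ℝ} {v : ℝ≥0}
    (hY : ∀ n, HasSubgaussianMGF (Y n) v μ)
    (hlim : ∀ᵐ ω ∂μ, Tendsto (fun n => Y n ω) atTop (𝓝 (Z ω))) : HasSubgaussianMGF Z v μ := by
  have hZ : AEMeasurable Z μ :=
    aemeasurable_of_tendsto_metrizable_ae' (fun n => (hY n).aemeasurable) hlim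
  have hfatou (s : ℝ) : ∫⁻ ω, ENNReal.ofReal (Real.exp (s * Z ω)) ∂μ ≤
      ENNReal.ofReal (Real.exp (v * s ^ 2 / 2)) := by
    calc ∫⁻ ω, ENNReal.ofReal (Real.exp (s * Z ω)) ∂μ
        = ∫⁻ ω, liminf (fun n => ENNReal.ofReal (Real.exp (s * Y n ω))) atTop ∂μ :=
          lintegral_congr_ae <| hlim.mono fun ω hω =>
            (ENNReal.tendsto_ofReal (hω.const_mul s).rexp).liminf_eq.symm
      _ ≤ liminf (fun n => ∫⁻ ω, ENNReal.ofReal (Real.exp (s * Y n ω)) ∂μ) atTop :=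
          lintegral_liminf_le' fun n =>
            ((hY n).aemeasurable.const_mul s).exp.ennreal_ofReal
      _ ≤ ENNReal.ofReal (Real.exp (v * s ^ 2 / 2)) := by
          refine liminf_le_of_frequently_le' (Frequently.of_forall fun n => ?_)
          rw [← ofReal_integral_eq_lintegral_ofReal ((hY n).integrable_exp_mul s)
            (ae_of_all _ fun ω => (Real.exp_pos _).le)]
          exact ENNReal.ofReal_le_ofReal ((hY n).mgf_le s)
  have hint (s : ℝ) : Integrable (fun ω => Real.exp (s * Z ω)) μ := by
    refine ⟨(hZ.const_mul s).exp.aestronglyMeasurable, ?_⟩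
    rw [hasFiniteIntegral_iff_ofReal (ae_of_all _ fun ω => (Real.exp_pos _).le)]
    exact (hfatou s).trans_lt ENNReal.ofReal_lt_top
  refine ⟨hint, fun s => (ENNReal.ofReal_le_ofReal_iff (Real.exp_pos _).le).1 ?_⟩
  rw [mgf, ofReal_integral_eq_lintegral_ofReal (hint s) (ae_of_all _ fun ω => (Real.exp_pos _).le)]
  exact hfatou s

theorem ae_exists_forall_mul_le {ι : Type*} [Countable ι] {f : ι → Ω → ℝ} {w : ι → ℝ} {m : ℝ}
    (hf : ∀ i, Integrable (f i) μ) (hf_nonneg : ∀ i ω, 0 ≤ f i ω) (hfm : ∀ i, ∫ ω, f i ω ∂μ ≤ m)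
    (hw : Summable w) (hw_nonneg : ∀ i, 0 ≤ w i) :
    ∀ᵐ ω ∂μ, ∃ T, ∀ i, w i * f i ω ≤ T := by
  set g : ι → Ω → ℝ≥0∞ := fun i ω => ENNReal.ofReal (w i * f i ω)
  have hg : ∀ i, AEMeasurable (g i) μ := fun i =>
    ((hf i).aestronglyMeasurable.aemeasurable.const_mul (w i)).ennreal_ofReal
  have hg_le (i : ι) : ∫⁻ ω, g i ω ∂μ ≤ ENNReal.ofReal (w i * m) := by
    rw [← ofReal_integral_eq_lintegral_ofReal ((hf i).const_mul (w i))
      (ae_of_all _ fun ω => mul_nonneg (hw_nonneg i) (hf_nonneg i ω)), integral_const_mul]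
    exact ENNReal.ofReal_le_ofReal (mul_le_mul_of_nonneg_left (hfm i) (hw_nonneg i))
  have hfin : ∫⁻ ω, ∑' i, g i ω ∂μ ≠ ⊤ := by
    rw [lintegral_tsum hg]
    exact ne_top_of_le_ne_top (hw.mul_right m).tsum_ofReal_ne_top (ENNReal.tsum_le_tsum hg_le)
  filter_upwards [ae_lt_top' (AEMeasurable.tsum hg) hfin] with ω hω
  exact ⟨(∑' i, g i ω).toReal, fun i =>
    (ENNReal.ofReal_le_iff_le_toReal hω.ne).1 (ENNReal.le_tsum (f := fun i => g i ω) i)⟩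

theorem integrable_exp_abs_and_integral_le {Y : Ω → ℝ} {v : ℝ≥0} (hY : HasSubgaussianMGF Y v μ) :
    Integrable (fun ω => Real.exp |Y ω|) μ ∧ ∫ ω, Real.exp |Y ω| ∂μ ≤ 2 * Real.exp (v / 2) := by
  have hpos := hY.integrable_exp_mul 1
  have hneg := hY.integrable_exp_mul (-1)
  have hle (ω : Ω) : Real.exp |Y ω| ≤ Real.exp (1 * Y ω) + Real.exp (-1 * Y ω) := by
    simpa only [one_mul, neg_mul] using Real.exp_abs_le (Y ω)
  have hint : Integrable (fun ω => Real.exp |Y ω|) μ :=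
    (hpos.add hneg).mono' (hY.aemeasurable.abs.exp.aestronglyMeasurable)
      (ae_of_all _ fun ω => by rw [Real.norm_of_nonneg (Real.exp_pos _).le]; exact hle ω)
  refine ⟨hint, ?_⟩
  calc ∫ ω, Real.exp |Y ω| ∂μ ≤ ∫ ω, (Real.exp (1 * Y ω) + Real.exp (-1 * Y ω)) ∂μ :=
        integral_mono hint (hpos.add hneg) hle
    _ = mgf Y μ 1 + mgf Y μ (-1) := integral_add hpos hneg
    _ ≤ Real.exp (v * 1 ^ 2 / 2) + Real.exp (v * (-1) ^ 2 / 2) :=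
        add_le_add (hY.mgf_le 1) (hY.mgf_le (-1))
    _ = 2 * Real.exp (v / 2) := by ring_nf

theorem ae_exists_abs_le_one_add_log {X : ℕ → Ω → ℝ} {v : ℝ≥0}
    (hX : ∀ j, HasSubgaussianMGF (X j) v μ) :
    ∀ᵐ ω ∂μ, ∃ A, ∀ j, |X j ω| ≤ A * (1 + Real.log (j + 1)) := by
  -- The series `∑ (j + 1)⁻² exp |X j|` has finite mean, so its terms are almost surely bounded.
  have hsum : Summable fun j : ℕ => (((j : ℝ) + 1) ^ 2)⁻¹ := by
    exact_mod_cast (summable_nat_add_iff 1).2 (Real.summable_nat_pow_inv.2 one_lt_two)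
  filter_upwards [ae_exists_forall_mul_le (fun j => (integrable_exp_abs_and_integral_le (hX j)).1)
    (fun _ _ => (Real.exp_pos _).le) (fun j => (integrable_exp_abs_and_integral_le (hX j)).2) hsum
    (fun _ => by positivity)] with ω ⟨T, hT⟩
  have hT_pos : 0 < T := lt_of_lt_of_le (by positivity) (hT 0)
  refine ⟨T + 2, fun j => ?_⟩
  have hexp : Real.exp |X j ω| ≤ ((j : ℝ) + 1) ^ 2 * T :=
    (inv_mul_le_iff₀ (by positivity)).1 (hT j)
  have hlog_nonneg : 0 ≤ Real.log ((j : ℝ) + 1) := Real.log_nonneg (by simp)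
  calc |X j ω| ≤ Real.log (((j : ℝ) + 1) ^ 2 * T) :=
        (Real.le_log_iff_exp_le (by positivity)).2 hexp
    _ = 2 * Real.log (j + 1) + Real.log T := by
        rw [Real.log_mul (by positivity) hT_pos.ne', Real.log_pow, Nat.cast_ofNat]
    _ ≤ (T + 2) * (1 + Real.log (j + 1)) := by
        nlinarith [Real.log_le_sub_one_of_pos hT_pos]

theorem abs_mul_add_le_mul_exp_abs {y δ : ℝ} (hδ : 0 < δ) (p q : ℝ) :
    |y| * (p + q) ≤ δ * (2 * Real.exp |δ⁻¹ * y| + (p ^ 2 + q ^ 2) / 2) := by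
  -- AM-GM for `|y| / δ` against `p` and `q`: the factor `δ` survives when `y` has size about `δ`.
  have hy : |y| = δ * |δ⁻¹ * y| := by
    rw [abs_mul, abs_of_pos (inv_pos.2 hδ), mul_inv_cancel_left₀ hδ.ne']
  have hquad : |δ⁻¹ * y| ^ 2 ≤ 2 * Real.exp |δ⁻¹ * y| := by
    linarith [Real.quadratic_le_exp_of_nonneg (abs_nonneg (δ⁻¹ * y)), abs_nonneg (δ⁻¹ * y)]
  rw [hy, mul_assoc]
  gcongr
  nlinarith [sq_nonneg (|δ⁻¹ * y| - p), sq_nonneg (|δ⁻¹ * y| - q)]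

theorem integrable_abs_mul_exp_add_exp_and_integral_le {D Y Z : Ω → ℝ} {δ v w : ℝ≥0} (hδ : 0 < δ)
    (hD : HasSubgaussianMGF D (δ ^ 2 * w) μ) (hY : HasSubgaussianMGF Y v μ)
    (hZ : HasSubgaussianMGF Z v μ) (σ : ℝ) :
    Integrable (fun ω => |D ω| * (Real.exp (σ * Y ω) + Real.exp (σ * Z ω))) μ ∧
      ∫ ω, |D ω| * (Real.exp (σ * Y ω) + Real.exp (σ * Z ω)) ∂μ ≤
        (4 * Real.exp (w / 2) + Real.exp (2 * σ ^ 2 * v)) * δ := by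
  have hscaled : HasSubgaussianMGF (fun ω => (δ : ℝ)⁻¹ * D ω) w μ := by
    refine hasSubgaussianMGF_const_mul hD (le_of_eq ?_)
    push_cast
    field_simp
  obtain ⟨hint_exp, hle_exp⟩ := integrable_exp_abs_and_integral_le hscaled
  have exp_sq (y : ℝ) : Real.exp (σ * y) ^ 2 = Real.exp (2 * σ * y) := by
    rw [← Real.exp_nat_mul, Nat.cast_ofNat, mul_assoc]
  have mgf_two_mul_le {U : Ω → ℝ} (hU : HasSubgaussianMGF U v μ) :
      ∫ ω, Real.exp (2 * σ * U ω) ∂μ ≤ Real.exp (2 * σ ^ 2 * v) :=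
    (hU.mgf_le (2 * σ)).trans_eq (by ring_nf)
  have hint_sq : Integrable (fun ω => (Real.exp (2 * σ * Y ω) + Real.exp (2 * σ * Z ω)) / 2) μ :=
    ((hY.integrable_exp_mul _).add (hZ.integrable_exp_mul _)).div_const 2
  have hbound (ω : Ω) : |D ω| * (Real.exp (σ * Y ω) + Real.exp (σ * Z ω)) ≤
      δ * (2 * Real.exp |(δ : ℝ)⁻¹ * D ω| +
        (Real.exp (2 * σ * Y ω) + Real.exp (2 * σ * Z ω)) / 2) := by
    simpa only [exp_sq] using
      abs_mul_add_le_mul_exp_abs (NNReal.coe_pos.2 hδ) (Real.exp (σ * Y ω)) (Real.exp (σ * Z ω))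
  have hint_bound := ((hint_exp.const_mul 2).add hint_sq).const_mul (δ : ℝ)
  have hint : Integrable (fun ω => |D ω| * (Real.exp (σ * Y ω) + Real.exp (σ * Z ω))) μ := by
    refine hint_bound.mono' ?_ (ae_of_all _ fun ω => ?_)
    · exact (hD.aemeasurable.abs.mul ((hY.aemeasurable.const_mul σ).exp.add
        (hZ.aemeasurable.const_mul σ).exp)).aestronglyMeasurable
    · rw [Real.norm_of_nonneg (by positivity)]
      exact hbound ω
  refine ⟨hint, (integral_mono hint hint_bound hbound).trans ?_⟩
  rw [integral_const_mul, mul_comm]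
  refine mul_le_mul_of_nonneg_right ?_ δ.coe_nonneg
  rw [integral_add' (hint_exp.const_mul 2) hint_sq, integral_const_mul, integral_div,
    integral_add (hY.integrable_exp_mul _) (hZ.integrable_exp_mul _)]
  linarith [mgf_two_mul_le hY, mgf_two_mul_le hZ]

end Subgaussian

section AsianCall

theorem asianCallPayoff_eq_setIntegral (r K : ℝ) (S : ℝ → ℝ) :
    asianCallPayoff r K S = Real.exp (-r) * max ((∫ t in Icc (0 : ℝ) 1, S t) - K) 0 := by
  rw [asianCallPayoff, intervalIntegral.integral_of_le zero_le_one, integral_Icc_eq_integral_Ioc]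

theorem abs_asianCallPayoff_sub_le {S S' : ℝ → ℝ} (hS : IntegrableOn S (Icc 0 1))
    (hS' : IntegrableOn S' (Icc 0 1)) (r K : ℝ) :
    |asianCallPayoff r K S - asianCallPayoff r K S'| ≤
      Real.exp (-r) * ∫ t in Icc (0 : ℝ) 1, |S t - S' t| := by
  rw [asianCallPayoff_eq_setIntegral, asianCallPayoff_eq_setIntegral, ← mul_sub, abs_mul,
    Real.abs_exp]
  gcongr
  calc |max ((∫ t in Icc (0 : ℝ) 1, S t) - K) 0 - max ((∫ t in Icc (0 : ℝ) 1, S' t) - K) 0|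
      ≤ |(∫ t in Icc (0 : ℝ) 1, S t) - K - ((∫ t in Icc (0 : ℝ) 1, S' t) - K)| :=
        abs_max_sub_max_le_abs _ _ _
    _ = |∫ t in Icc (0 : ℝ) 1, (S t - S' t)| := by
        rw [sub_sub_sub_cancel_right, integral_sub hS hS']
    _ ≤ ∫ t in Icc (0 : ℝ) 1, |S t - S' t| := abs_integral_le_integral_abs

theorem abs_exp_sub_exp_le (a b : ℝ) :
    |Real.exp a - Real.exp b| ≤ |a - b| * (Real.exp a + Real.exp b) := by
  have exp_sub_exp_le (u v : ℝ) :
      Real.exp u - Real.exp v ≤ |u - v| * (Real.exp u + Real.exp v) :=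
    calc Real.exp u - Real.exp v = (1 - Real.exp (v - u)) * Real.exp u := by
          rw [sub_mul, one_mul, ← Real.exp_add, sub_add_cancel]
      _ ≤ (u - v) * Real.exp u :=
          mul_le_mul_of_nonneg_right (by linarith [Real.add_one_le_exp (v - u)])
            (Real.exp_pos u).le
      _ ≤ |u - v| * (Real.exp u + Real.exp v) := by
          gcongr
          · exact le_abs_self _
          · exact le_add_of_nonneg_right (Real.exp_pos v).le
  refine abs_sub_le_iff.2 ⟨exp_sub_exp_le a b, ?_⟩
  rw [abs_sub_comm, add_comm]
  exact exp_sub_exp_le b a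

theorem exp_neg_mul_abs_assetPrice_sub_le (S₀ r σ : ℝ) (b b' : ℝ → ℝ) {t : ℝ}
    (ht : t ∈ Icc (0 : ℝ) 1) :
    Real.exp (-r) * |assetPrice S₀ r σ b t - assetPrice S₀ r σ b' t| ≤
      |S₀| * Real.exp |r| * |σ| *
        (|b t - b' t| * (Real.exp (σ * b t) + Real.exp (σ * b' t))) := by
  have hdrift : -r + (r - σ ^ 2 / 2) * t ≤ |r| := by
    linarith [mul_nonneg (sq_nonneg σ) ht.1, mul_nonneg (abs_nonneg r) ht.1,
      mul_le_mul_of_nonneg_right (neg_abs_le r) (sub_nonneg.2 ht.2)]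
  calc Real.exp (-r) * |assetPrice S₀ r σ b t - assetPrice S₀ r σ b' t|
      = |S₀| * Real.exp (-r + (r - σ ^ 2 / 2) * t) *
          |Real.exp (σ * b t) - Real.exp (σ * b' t)| := by
        rw [assetPrice, assetPrice, Real.exp_add, Real.exp_add, Real.exp_add, ← mul_sub, ← mul_sub,
          abs_mul, abs_mul, Real.abs_exp]
        ring
    _ ≤ |S₀| * Real.exp |r| *
          (|σ * b t - σ * b' t| * (Real.exp (σ * b t) + Real.exp (σ * b' t))) := by
        gcongr
        exact abs_exp_sub_exp_le _ _
    _ = |S₀| * Real.exp |r| * |σ| *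
          (|b t - b' t| * (Real.exp (σ * b t) + Real.exp (σ * b' t))) := by
        rw [← mul_sub, abs_mul]
        ring

theorem continuousOn_assetPrice (S₀ r σ : ℝ) {b : ℝ → ℝ} {s : Set ℝ} (hb : ContinuousOn b s) :
    ContinuousOn (assetPrice S₀ r σ b) s := by
  unfold assetPrice
  fun_prop

theorem abs_asianCallPayoff_assetPrice_sub_le {b b' : ℝ → ℝ} (hb : ContinuousOn b (Icc 0 1))
    (hb' : ContinuousOn b' (Icc 0 1)) (S₀ r σ K : ℝ) :
    |asianCallPayoff r K (assetPrice S₀ r σ b) - asianCallPayoff r K (assetPrice S₀ r σ b')| ≤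
      |S₀| * Real.exp |r| * |σ| *
        ∫ t in Icc (0 : ℝ) 1, |b t - b' t| * (Real.exp (σ * b t) + Real.exp (σ * b' t)) := by
  have hS := continuousOn_assetPrice S₀ r σ hb
  have hS' := continuousOn_assetPrice S₀ r σ hb'
  refine (abs_asianCallPayoff_sub_le hS.integrableOn_Icc hS'.integrableOn_Icc r K).trans ?_
  rw [← integral_const_mul, ← integral_const_mul]
  refine setIntegral_mono_on ?_ ?_ measurableSet_Icc fun t ht =>
    exp_neg_mul_abs_assetPrice_sub_le S₀ r σ b b' ht
  · exact ContinuousOn.integrableOn_Icc (by fun_prop)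
  · exact ContinuousOn.integrableOn_Icc (by fun_prop)

end AsianCall

theorem integrable_prod_and_integral_integral_le {α β : Type*} [MeasurableSpace α]
    [MeasurableSpace β] {μ : Measure α} {ν : Measure β} [SFinite μ] [IsFiniteMeasure ν]
    {F : α × β → ℝ} {C : ℝ} (hF : AEStronglyMeasurable F (μ.prod ν)) (hF_nonneg : ∀ p, 0 ≤ F p)
    (hF_section : ∀ᵐ y ∂ν, Integrable (fun x => F (x, y)) μ ∧ ∫ x, F (x, y) ∂μ ≤ C) :
    Integrable F (μ.prod ν) ∧ ∫ x, ∫ y, F (x, y) ∂ν ∂μ ≤ C * ν.real univ := by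
  have hint : Integrable F (μ.prod ν) := by
    refine (integrable_prod_iff' hF).2 ⟨hF_section.mono fun y hy => hy.1, ?_⟩
    refine (integrable_const C).mono' hF.norm.prod_swap.integral_prod_right' ?_
    filter_upwards [hF_section] with y hy
    rw [Real.norm_of_nonneg (integral_nonneg fun x => norm_nonneg _)]
    simpa only [Real.norm_of_nonneg (hF_nonneg _)] using hy.2
  refine ⟨hint, ?_⟩
  calc ∫ x, ∫ y, F (x, y) ∂ν ∂μ = ∫ y, ∫ x, F (x, y) ∂μ ∂ν := integral_integral_swap hint
    _ ≤ ∫ _, C ∂ν :=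
        integral_mono_ae hint.integral_prod_right (integrable_const C)
          (hF_section.mono fun y hy => hy.2)
    _ = C * ν.real univ := by rw [integral_const, smul_eq_mul, mul_comm]

/-- A random path `Y t ω`, `t ∈ [0, 1]`, that is jointly measurable, almost surely continuous, and
sub-Gaussian with the same variance proxy `v` at every time. Measurability is required up to null
sets only, since such paths arise as almost sure limits. -/
structure IsSubgaussianPath {Ω : Type*} [MeasurableSpace Ω] (Y : ℝ → Ω → ℝ) (v : ℝ≥0)
    (μ : Measure Ω) : Prop where
  aemeasurable : AEMeasurable (fun p : Ω × ℝ => Y p.2 p.1) (μ.prod (volume.restrict (Icc 0 1)))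
  continuousOn : ∀ᵐ ω ∂μ, ContinuousOn (fun t => Y t ω) (Icc 0 1)
  hasSubgaussianMGF : ∀ t ∈ Icc (0 : ℝ) 1, HasSubgaussianMGF (Y t) v μ

namespace IsSubgaussianPath

variable {Ω : Type*} [MeasurableSpace Ω] {μ : Measure Ω} {Y Z : ℝ → Ω → ℝ} {v : ℝ≥0}

theorem aestronglyMeasurable_asianCallPayoff (hY : IsSubgaussianPath Y v μ) (S₀ r σ K : ℝ) :
    AEStronglyMeasurable
      (fun ω => asianCallPayoff r K (assetPrice S₀ r σ fun t => Y t ω)) μ := by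
  have hprice : AEMeasurable (fun p : Ω × ℝ => assetPrice S₀ r σ (fun t => Y t p.1) p.2)
      (μ.prod (volume.restrict (Icc 0 1))) :=
    (((measurable_snd.const_mul _).aemeasurable.add (hY.aemeasurable.const_mul σ)).exp).const_mul S₀
  have havg := hprice.aestronglyMeasurable.integral_prod_right'.aemeasurable
  simp only [asianCallPayoff_eq_setIntegral]
  exact (((havg.sub_const K).max aemeasurable_const).const_mul _).aestronglyMeasurable

theorem integrable_asianCallPayoff_sub_and_integral_abs_le [SFinite μ] {δ w : ℝ≥0}
    (hY : IsSubgaussianPath Y v μ) (hZ : IsSubgaussianPath Z v μ) (hδ : 0 < δ)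
    (hYZ : ∀ t ∈ Icc (0 : ℝ) 1, HasSubgaussianMGF (fun ω => Y t ω - Z t ω) (δ ^ 2 * w) μ)
    (S₀ r σ K : ℝ) :
    Integrable (fun ω => asianCallPayoff r K (assetPrice S₀ r σ fun t => Y t ω) -
      asianCallPayoff r K (assetPrice S₀ r σ fun t => Z t ω)) μ ∧
    ∫ ω, |asianCallPayoff r K (assetPrice S₀ r σ fun t => Y t ω) -
        asianCallPayoff r K (assetPrice S₀ r σ fun t => Z t ω)| ∂μ ≤
      |S₀| * Real.exp |r| * |σ| * ((4 * Real.exp (w / 2) + Real.exp (2 * σ ^ 2 * v)) * δ) := by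
  set c := |S₀| * Real.exp |r| * |σ|
  set F : Ω × ℝ → ℝ := fun p => |Y p.2 p.1 - Z p.2 p.1| *
    (Real.exp (σ * Y p.2 p.1) + Real.exp (σ * Z p.2 p.1))
  have hF : AEStronglyMeasurable F (μ.prod (volume.restrict (Icc 0 1))) :=
    ((hY.aemeasurable.sub hZ.aemeasurable).abs.mul ((hY.aemeasurable.const_mul σ).exp.add
      (hZ.aemeasurable.const_mul σ).exp)).aestronglyMeasurable
  obtain ⟨hF_int, hF_le⟩ := integrable_prod_and_integral_integral_le hF
    (fun p => by positivity) (ae_restrict_of_forall_mem measurableSet_Icc fun t ht =>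
      integrable_abs_mul_exp_add_exp_and_integral_le hδ (hYZ t ht) (hY.hasSubgaussianMGF t ht)
        (hZ.hasSubgaussianMGF t ht) σ)
  rw [measureReal_restrict_apply_univ, Real.volume_real_Icc_of_le zero_le_one, sub_zero,
    mul_one] at hF_le
  have hpath : ∀ᵐ ω ∂μ, |asianCallPayoff r K (assetPrice S₀ r σ fun t => Y t ω) -
      asianCallPayoff r K (assetPrice S₀ r σ fun t => Z t ω)| ≤
        c * ∫ t in Icc (0 : ℝ) 1, F (ω, t) := by
    filter_upwards [hY.continuousOn, hZ.continuousOn] with ω hYω hZω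
    exact abs_asianCallPayoff_assetPrice_sub_le hYω hZω S₀ r σ K
  have hbound_int : Integrable (fun ω => c * ∫ t in Icc (0 : ℝ) 1, F (ω, t)) μ :=
    hF_int.integral_prod_left.const_mul c
  have hint := hbound_int.mono' ((hY.aestronglyMeasurable_asianCallPayoff S₀ r σ K).sub
    (hZ.aestronglyMeasurable_asianCallPayoff S₀ r σ K)) hpath
  refine ⟨hint, (integral_mono_ae hint.abs hbound_int hpath).trans ?_⟩
  rw [integral_const_mul]
  gcongr

end IsSubgaussianPath

section LevyCiesielski

theorem sum_Ico_sq_le_two_mul_half_pow {c : ℕ → ℝ} (hc : ∀ n, |c n| ≤ √(1 / 2) ^ n) (m n : ℕ) :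
    ∑ i ∈ Finset.Ico m n, c i ^ 2 ≤ 2 * (1 / 2) ^ m := by
  have hsq (i : ℕ) : c i ^ 2 ≤ (1 / 2) ^ i :=
    calc c i ^ 2 ≤ (√(1 / 2) ^ i) ^ 2 := sq_le_sq' (abs_le.1 (hc i)).1 (abs_le.1 (hc i)).2
      _ = (1 / 2) ^ i := by rw [pow_right_comm, Real.sq_sqrt (by norm_num)]
  calc ∑ i ∈ Finset.Ico m n, c i ^ 2 ≤ ∑ i ∈ Finset.Ico m n, (1 / 2) ^ i :=
        Finset.sum_le_sum fun i _ => hsq i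
    _ ≤ (1 / 2) ^ m / (1 - 1 / 2) := geom_sum_Ico_le_of_lt_one (by norm_num) (by norm_num)
    _ = 2 * (1 / 2) ^ m := by ring

variable {Ω : Type*} [MeasurableSpace Ω] {μ : Measure Ω} {X : ℕ → Ω → ℝ} {v : ℝ≥0}

theorem hasSubgaussianMGF_lcTrunc (hX : ∀ j, HasSubgaussianMGF (X j) v μ) (hind : iIndepFun X μ)
    (N : ℕ) {t : ℝ} (ht : t ∈ Icc (0 : ℝ) 1) :
    HasSubgaussianMGF (fun ω => lcTrunc (fun j => X j ω) N t) (2 * v) μ := by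
  obtain ⟨k, c, hk, hc, htrunc⟩ := exists_lcTrunc_eq_sum_mul ht
  simp only [htrunc, Finset.range_eq_Ico]
  refine hasSubgaussianMGF_sum_mul (fun n => hX (k n)) (hind.precomp hk.injective) ?_
  simpa only [pow_zero, mul_one, NNReal.coe_ofNat] using sum_Ico_sq_le_two_mul_half_pow hc 0 (N + 1)

theorem hasSubgaussianMGF_lcTrunc_sub_lcTrunc (hX : ∀ j, HasSubgaussianMGF (X j) v μ)
    (hind : iIndepFun X μ) {N M : ℕ} (hNM : N ≤ M) {t : ℝ} (ht : t ∈ Icc (0 : ℝ) 1) :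
    HasSubgaussianMGF (fun ω => lcTrunc (fun j => X j ω) M t - lcTrunc (fun j => X j ω) N t)
      ((1 / 2) ^ N * v) μ := by
  obtain ⟨k, c, hk, hc, htrunc⟩ := exists_lcTrunc_eq_sum_mul ht
  simp only [htrunc, ← Finset.sum_Ico_eq_sub _ (Nat.succ_le_succ hNM)]
  refine hasSubgaussianMGF_sum_mul (fun n => hX (k n)) (hind.precomp hk.injective) ?_
  refine (sum_Ico_sq_le_two_mul_half_pow hc (N + 1) (M + 1)).trans_eq ?_
  push_cast
  ring

theorem isSubgaussianPath_lcTrunc (hX : ∀ j, HasSubgaussianMGF (X j) v μ) (hind : iIndepFun X μ)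
    (N : ℕ) : IsSubgaussianPath (fun t ω => lcTrunc (fun j => X j ω) N t) (2 * v) μ where
  aemeasurable := (continuous_lcTrunc N).measurable.comp_aemeasurable
    ((aemeasurable_pi_lambda _ fun j => (hX j).aemeasurable.comp_fst).prodMk
      measurable_snd.aemeasurable)
  continuousOn := ae_of_all _ fun ω =>
    ((continuous_lcTrunc N).comp (Continuous.prodMk_right fun j => X j ω)).continuousOn
  hasSubgaussianMGF _ ht := hasSubgaussianMGF_lcTrunc hX hind N ht

variable {B : ℝ → Ω → ℝ}

theorem ae_tendsto_lcTrunc (hX : ∀ j, HasSubgaussianMGF (X j) v μ)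
    (hB : ∀ᵐ ω ∂μ, ∀ t ∈ Icc (0 : ℝ) 1, B t ω = lcPath (fun j => X j ω) t) :
    ∀ᵐ ω ∂μ, ∀ t ∈ Icc (0 : ℝ) 1,
      Tendsto (fun N => lcTrunc (fun j => X j ω) N t) atTop (𝓝 (B t ω)) := by
  filter_upwards [hB, ae_exists_abs_le_one_add_log hX] with ω hBω ⟨A, hA⟩ t ht
  rw [hBω t ht]
  exact tendsto_lcTrunc hA t

theorem isSubgaussianPath_lcPath (hX : ∀ j, HasSubgaussianMGF (X j) v μ)
    (hind : iIndepFun X μ)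
    (hB : ∀ᵐ ω ∂μ, ∀ t ∈ Icc (0 : ℝ) 1, B t ω = lcPath (fun j => X j ω) t) :
    IsSubgaussianPath B (2 * v) μ where
  aemeasurable := by
    refine aemeasurable_of_tendsto_metrizable_ae'
      (fun N => (isSubgaussianPath_lcTrunc hX hind N).aemeasurable) ?_
    filter_upwards [Measure.quasiMeasurePreserving_fst.ae (ae_tendsto_lcTrunc hX hB),
      Measure.quasiMeasurePreserving_snd.ae (ae_restrict_mem measurableSet_Icc)] with p hp hp_mem
    exact hp p.2 hp_mem
  continuousOn := by
    filter_upwards [hB, ae_exists_abs_le_one_add_log hX] with ω hBω ⟨A, hA⟩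
    exact (continuous_lcPath hA).continuousOn.congr hBω
  hasSubgaussianMGF t ht :=
    hasSubgaussianMGF_of_tendsto_ae (fun N => hasSubgaussianMGF_lcTrunc hX hind N ht)
      ((ae_tendsto_lcTrunc hX hB).mono fun _ hω => hω t ht)

theorem hasSubgaussianMGF_lcPath_sub_lcTrunc (hX : ∀ j, HasSubgaussianMGF (X j) v μ)
    (hind : iIndepFun X μ)
    (hB : ∀ᵐ ω ∂μ, ∀ t ∈ Icc (0 : ℝ) 1, B t ω = lcPath (fun j => X j ω) t)
    (N : ℕ) {t : ℝ} (ht : t ∈ Icc (0 : ℝ) 1) :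
    HasSubgaussianMGF (fun ω => B t ω - lcTrunc (fun j => X j ω) N t) ((1 / 2) ^ N * v) μ :=
  hasSubgaussianMGF_of_tendsto_ae
    (fun M => hasSubgaussianMGF_lcTrunc_sub_lcTrunc hX hind (Nat.le_add_left N M) ht)
    ((ae_tendsto_lcTrunc hX hB).mono fun _ hω =>
      ((tendsto_add_atTop_iff_nat N).2 (hω t ht)).sub_const _)

end LevyCiesielski

theorem mainTheorem3_general {Ω : Type*} [MeasurableSpace Ω] {μ : Measure Ω} {v : ℝ≥0}
    {X : ℕ → Ω → ℝ} (hX : ∀ j, HasSubgaussianMGF (X j) v μ) (hind : iIndepFun X μ)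
    {B : ℝ → Ω → ℝ}
    (hB : ∀ᵐ ω ∂μ, ∀ t ∈ Icc (0 : ℝ) 1, B t ω = lcPath (fun j => X j ω) t)
    (S₀ r σ K : ℝ) :
    (∀ᵐ ω ∂μ, (∀ t ∈ Icc (0 : ℝ) 1, Summable fun n : ℕ => lcLevel (fun j => X j ω) (n + 1) t) ∧
      ContinuousOn (fun t => B t ω) (Icc 0 1)) ∧
    ∃ C : ℝ, 0 < C ∧ ∀ N : ℕ,
      Integrable (fun ω => asianCallPayoff r K (assetPrice S₀ r σ fun t => B t ω) -
        asianCallPayoff r K (assetPrice S₀ r σ (lcTrunc (fun j => X j ω) N))) μ ∧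
      ∫ ω, |asianCallPayoff r K (assetPrice S₀ r σ fun t => B t ω) -
        asianCallPayoff r K (assetPrice S₀ r σ (lcTrunc (fun j => X j ω) N))| ∂μ ≤
          C / (2 : ℝ) ^ ((N : ℝ) / 2) := by
  have : IsProbabilityMeasure μ := hind.isProbabilityMeasure
  have hpath := isSubgaussianPath_lcPath hX hind hB
  constructor
  · filter_upwards [hpath.continuousOn, ae_exists_abs_le_one_add_log hX] with ω hω ⟨A, hA⟩
    exact ⟨fun t _ => summable_lcLevel hA t, hω⟩
  set C₀ := |S₀| * Real.exp |r| * |σ| *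
    (4 * Real.exp (v / 2) + Real.exp (2 * σ ^ 2 * (2 * v : ℝ≥0)))
  refine ⟨C₀ + 1, by positivity, fun N => ?_⟩
  set δ : ℝ≥0 := NNReal.sqrt (1 / 2) ^ N
  have hδ_sq : δ ^ 2 = (1 / 2) ^ N := by rw [pow_right_comm, NNReal.sq_sqrt]
  have hδ_coe : (δ : ℝ) = 1 / (2 : ℝ) ^ ((N : ℝ) / 2) := by
    rw [← sqrt_half_pow_eq_one_div_two_rpow, NNReal.coe_pow, Real.coe_sqrt, NNReal.coe_div,
      NNReal.coe_one, NNReal.coe_ofNat]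
  have hδ : 0 < δ := by positivity
  have hdiff (t : ℝ) (ht : t ∈ Icc (0 : ℝ) 1) :
      HasSubgaussianMGF (fun ω => B t ω - lcTrunc (fun j => X j ω) N t) (δ ^ 2 * v) μ :=
    hδ_sq ▸ hasSubgaussianMGF_lcPath_sub_lcTrunc hX hind hB N ht
  obtain ⟨hint, hle⟩ := hpath.integrable_asianCallPayoff_sub_and_integral_abs_le
    (isSubgaussianPath_lcTrunc hX hind N) hδ hdiff S₀ r σ K
  refine ⟨hint, hle.trans ?_⟩
  rw [← mul_assoc, hδ_coe, mul_one_div]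
  gcongr
  exact le_add_of_nonneg_right zero_le_one

theorem div_two_rpow_le_mul_sqrt_div {C : ℝ} (hC : 0 ≤ C) {N : ℕ} (hN : 1 ≤ N) :
    C / (2 : ℝ) ^ ((N : ℝ) / 2) ≤ C * (√N / (2 : ℝ) ^ ((N : ℝ) / 2)) := by
  rw [← mul_div_assoc]
  gcongr
  exact le_mul_of_one_le_right hC (Real.one_le_sqrt.2 (by exact_mod_cast hN))

theorem sqrt_log_two_pow_div (N : ℕ) :
    √(Real.log (2 ^ N) / 2 ^ N) = √(Real.log 2) * (√N / (2 : ℝ) ^ ((N : ℝ) / 2)) := by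
  rw [Real.log_pow, Real.sqrt_div (by positivity), Real.sqrt_mul N.cast_nonneg,
    Real.sqrt_eq_rpow (2 ^ N), ← Real.rpow_natCast_mul zero_le_two, mul_one_div]
  ring

theorem mainTheorem3
    {Ω : Type*} [MeasurableSpace Ω] (μ : Measure Ω) [IsProbabilityMeasure μ]
    -- independent standard normal coefficients
    (X : ℕ → Ω → ℝ) (hX : ∀ j, HasLaw (X j) (gaussianReal 0 1) μ) (hind : iIndepFun X μ)
    -- almost surely, the path of `B` on `[0,1]` is the Lévy–Ciesielski series
    (B : ℝ → Ω → ℝ)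
    (hB : ∀ᵐ ω ∂μ, ∀ t ∈ Icc (0 : ℝ) 1, B t ω = lcPath (fun j => X j ω) t)
    (S₀ r σ K : ℝ) (hr : 0 < r) (hσ : 0 < σ)
    (P : Ω → ℝ)
    (hP : ∀ ω, P ω = asianCallPayoff r K (assetPrice S₀ r σ (fun t => B t ω)))
    (PN : ℕ → Ω → ℝ)
    (hPN : ∀ N ω, PN N ω =
      asianCallPayoff r K (assetPrice S₀ r σ (lcTrunc (fun j => X j ω) N))) :
    -- the objects are well defined: almost surely the series converges and `B` is continuous
    (∀ᵐ ω ∂μ, (∀ t ∈ Icc (0 : ℝ) 1, Summable fun n : ℕ => lcLevel (fun j => X j ω) (n + 1) t) ∧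
      ContinuousOn (fun t => B t ω) (Icc 0 1)) ∧
    (∀ N : ℕ, 1 ≤ N → Integrable (fun ω => P ω - PN N ω) μ) ∧
    -- the two forms of the error bound, with `d = 2 ^ N`
    (∃ C : ℝ, 0 < C ∧ ∀ N : ℕ, 1 ≤ N →
      ∫ ω, |P ω - PN N ω| ∂μ ≤ C * (Real.sqrt N / (2 : ℝ) ^ ((N : ℝ) / 2))) ∧
    (∃ C : ℝ, 0 < C ∧ ∀ N : ℕ, 1 ≤ N → ∀ d : ℝ, d = 2 ^ N →
      ∫ ω, |P ω - PN N ω| ∂μ ≤ C * Real.sqrt (Real.log d / d)) := by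
  obtain rfl : P = _ := funext hP
  obtain rfl : PN = _ := funext₂ hPN
  obtain ⟨hconv, C, hC, hrate⟩ := mainTheorem3_general
    (fun j => hasSubgaussianMGF_of_hasLaw_gaussianReal (hX j)) hind hB S₀ r σ K
  have hrate_sqrt (N : ℕ) (hN : 1 ≤ N) := (hrate N).2.trans (div_two_rpow_le_mul_sqrt_div hC.le hN)
  refine ⟨hconv, fun N _ => (hrate N).1, ⟨C, hC, hrate_sqrt⟩, C / √(Real.log 2), by positivity, ?_⟩
  rintro N hN _ rfl
  rw [sqrt_log_two_pow_div, ← mul_assoc, div_mul_cancel₀ C (by positivity)]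
  exact hrate_sqrt N hN
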